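/- The Evacuation Problem (\textsf{EP}) is NP-hard. Definitions. Let $P$ be a finite set of people, $T=\{0,\dots,t_{\max}\}$ the time points. A building graph is $G=\langle V,E,EX,c,d\rangle$ with $V$ finite, $E\subseteq V\times V$, exits $EX\subsetneq V$, and capacity and travel-time functions $c,d:V\cup E\to\mathbb Z$ such that $d(v)=0$ for $v\in V$ and $c(v)\ge|P|$ for $v\in EX$. A state is a map $P\to V\cup E$; $s_0$ is the state at time $0$. A weak evacuation schedule (WES) is a map $w$ from $T$ to states with $w(0)=s_0$ such that, for every $p\in P$, writing $w_p(t)=w(t)(p)$: (1) if $w_p(t)=v_1\in V$ and $t<t_{\max}$, then $w_p(t+1)$ is $v_1$, or some $e=(v_1,v_2)\in E$, or $v_2$ for some $(v_1,v_2)\in E$; (2) if $w_p(t)=e=(v_1,v_2)\in E$ and $t<t_{\max}$, then $w_p(t+1)\in\{e,v_1,v_2\}$; (3) if $e=(v_1,v_2)\in E$, $w_p(t)=v_1$ and $w_p(t+k)=v_2$ with $k\ge 0$, then $d(e)\le k$; (4) if $w_p(t')\in EX$ and $t'<t''\le t_{\max}$, then $w_p(t'')=w_p(t')$. A strong evacuation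 schedule (SES) is a WES in which, at each time, each $x\in V\cup E$ holds at most $c(x)$ people, and in which all people are at exits at time $t_{\max}$. A behavior model $\beta$ assigns to each SES a probability distribution on the finite set of WESs. For $D\le t_{\max}$ let $N_w(D)$ be the number of people at an exit at time $D$ under $w$, and $\mathbb E[N_{es}(D)]=\sum_{w}\beta(es)(w)\,N_w(D)$. \textsf{EP}: given $G$, $P$, $t_{\max}$, $s_0$, $\beta$ and a deadline $D\le t_{\max}$, find an SES $es$ that maximizes $\mathbb E[N_{es}(D)]$, or report that there is no SES. The sets $V,P,T$ are given explicitly, capacities and travel times in binary, and $\beta$ (with rational probabilities) is given by a program, a parameter string and a unary bound on its running time: on the parameter and any SES $es$ the program outputs, within the bound, $\beta(es)$ as a list of WESs with their probabilities. Theorem. \textsf{EP} is NP-hard: for every language $L$ in NP, membership in $L$ can be decided in polynomial time given an oracle that returns correct answers to instances of \textsf{EP}. In fact one query suffices: an instance of \textsf{EP} can be computed from $x$ in polynomial time such that, from $x$ and any correct answer to this instance, a program decides whether $x\in L$ in time polynomial in $|x|$. -/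

import Mathlib

/-! ## A machine model with a step count

Deterministic programs over finitely many registers. Each register holds a bit string that is used
as a stack: an elementary step pushes one bit, pops one bit or inspects the top bit of one register.
Two registers simulate one tape of a Turing machine and conversely, with constant overhead per step,
so that polynomial time in this model is polynomial time on multitape Turing machines. -/

namespace Evac

/-- Programs. -/
inductive Prog where
  | skip
  | push (r : ℕ) (b : Bool)
  | pop (r : ℕ)
  | seq (p q : Prog)
  /-- Inspect register `r`: run `pn` if it is empty, `pf` if its top is `false`, `pt` if its top
  is `true` (the register itself is not changed). -/
  | branch (r : ℕ) (pn pf pt : Prog)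
  /-- Repeat `p` as long as register `r` is not empty. -/
  | loop (r : ℕ) (p : Prog)

/-- Contents of the registers; the top of a register is the head of the list. -/
abbrev Store := ℕ → List Bool

/-- `p.Exec s s' t`: started on the store `s`, the program `p` halts with the store `s'` after
exactly `t` steps. -/
inductive Prog.Exec : Prog → Store → Store → ℕ → Prop where
  | skip (s : Store) : Prog.Exec .skip s s 1
  | push (r : ℕ) (b : Bool) (s : Store) :
      Prog.Exec (.push r b) s (Function.update s r (b :: s r)) 1
  | pop (r : ℕ) (s : Store) : Prog.Exec (.pop r) s (Function.update s r (s r).tail) 1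
  | seq {p q : Prog} {s s' s'' : Store} {a b : ℕ} :
      Prog.Exec p s s' a → Prog.Exec q s' s'' b → Prog.Exec (.seq p q) s s'' (a + b)
  | branchNil {r : ℕ} {pn pf pt : Prog} {s s' : Store} {a : ℕ} :
      s r = [] → Prog.Exec pn s s' a → Prog.Exec (.branch r pn pf pt) s s' (a + 1)
  | branchFalse {r : ℕ} {pn pf pt : Prog} {s s' : Store} {a : ℕ} :
      (s r).head? = some false → Prog.Exec pf s s' a →
        Prog.Exec (.branch r pn pf pt) s s' (a + 1)
  | branchTrue {r : ℕ} {pn pf pt : Prog} {s s' : Store} {a : ℕ} :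
      (s r).head? = some true → Prog.Exec pt s s' a →
        Prog.Exec (.branch r pn pf pt) s s' (a + 1)
  | loopDone {r : ℕ} {p : Prog} {s : Store} : s r = [] → Prog.Exec (.loop r p) s s 1
  | loopStep {r : ℕ} {p : Prog} {s s' s'' : Store} {a b : ℕ} :
      s r ≠ [] → Prog.Exec p s s' a → Prog.Exec (.loop r p) s' s'' b →
        Prog.Exec (.loop r p) s s'' (a + b + 1)

/-- The initial store: the `i`-th input in register `i`, all other registers empty. -/
def initStore (inputs : List (List Bool)) : Store := fun r => inputs.getD r []

/-- On the given inputs, `p` halts within `T` steps with `z` in register `0`. -/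
def Prog.OutputsWithin (p : Prog) (inputs : List (List Bool)) (z : List Bool) (T : ℕ) : Prop :=
  ∃ (s : Store) (t : ℕ), t ≤ T ∧ p.Exec (initStore inputs) s t ∧ s 0 = z

/-! ## Polynomial time, NP, and NP-hardness of search problems -/

/-- `f` is computable in polynomial time. -/
def PolyTime (f : List Bool → List Bool) : Prop :=
  ∃ (p : Prog) (q : Polynomial ℕ), ∀ x, p.OutputsWithin [x] (f x) (q.eval x.length)

/-- A function of two strings that is computable in polynomial time. -/
def PolyTime₂ (f : List Bool → List Bool → List Bool) : Prop :=
  ∃ (p : Prog) (q : Polynomial ℕ), ∀ x y,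
    p.OutputsWithin [x, y] (f x y) (q.eval (x.length + y.length))

/-- The class NP: membership has polynomial-size certificates checkable in polynomial time. -/
def InNP (L : Language Bool) : Prop :=
  ∃ (verify : List Bool → List Bool → List Bool) (q : Polynomial ℕ), PolyTime₂ verify ∧
    ∀ x, x ∈ L ↔ ∃ c : List Bool, c.length ≤ q.eval x.length ∧ verify x c = [true]

/-- A search problem: instances, their encoding as bit strings, and the correct answers. -/
structure SearchProblem where
  Inst : Type
  encode : Inst → List Bool
  IsAnswer : Inst → List Bool → Prop

/-- A search problem is NP-hard if every language `L` in NP can be decided in polynomial time with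
access to correct answers for it. We demand this with a single query: an instance `R x` is computed
from `x` in polynomial time, it has a correct answer, and from `x` and any correct answer `y`
to `R x` a program decides `x ∈ L` in time polynomial in the length of `x`. -/
def SearchProblem.NPHard (Q : SearchProblem) : Prop :=
  ∀ L : Language Bool, InNP L →
    ∃ (R : List Bool → Q.Inst) (p : Prog) (q : Polynomial ℕ),
      PolyTime (fun x => Q.encode (R x)) ∧
      ∀ x, (∃ y, Q.IsAnswer (R x) y) ∧
        ∀ y, Q.IsAnswer (R x) y →
          ∃ z, p.OutputsWithin [x, y] z (q.eval x.length) ∧ (x ∈ L ↔ z = [true])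

/-! ## The evacuation framework -/

/-- Building graphs for the set `P` of people, on the vertex set `V`. The functions `c` (capacity)
and `d` (travel time) are defined on `V ∪ E`. -/
structure BuildingGraph (V P : Type) [Fintype V] [Fintype P] where
  E : Finset (V × V)
  EX : Finset V
  EX_ssubset : EX ⊂ Finset.univ
  c : V ⊕ E → ℤ
  d : V ⊕ E → ℤ
  d_vertex : ∀ v : V, d (.inl v) = 0
  c_exit : ∀ v ∈ EX, (Fintype.card P : ℤ) ≤ c (.inl v)

section Framework

variable {V P : Type} [Fintype V] [Fintype P]

/-- `V ∪ E`. -/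
abbrev BuildingGraph.Loc (G : BuildingGraph V P) : Type := V ⊕ G.E

/-- A state says where each person is. -/
abbrev BuildingGraph.State (G : BuildingGraph V P) : Type := P → G.Loc

/-- `w` maps the time points `0, …, tmax` to states and is a weak evacuation schedule with
initial state `s₀`. -/
structure IsWES (G : BuildingGraph V P) (s₀ : G.State) {tmax : ℕ}
    (w : Fin (tmax + 1) → G.State) : Prop where
  start : w 0 = s₀
  from_vertex : ∀ (p : P) (t : Fin tmax) (v₁ : V), w t.castSucc p = .inl v₁ →
    w t.succ p = .inl v₁ ∨
    (∃ e : G.E, e.1.1 = v₁ ∧ w t.succ p = .inr e) ∨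
    (∃ e : G.E, e.1.1 = v₁ ∧ w t.succ p = .inl e.1.2)
  from_edge : ∀ (p : P) (t : Fin tmax) (e : G.E), w t.castSucc p = .inr e →
    w t.succ p = .inr e ∨ w t.succ p = .inl e.1.1 ∨ w t.succ p = .inl e.1.2
  travel : ∀ (p : P) (e : G.E) (t t' : Fin (tmax + 1)), t ≤ t' →
    w t p = .inl e.1.1 → w t' p = .inl e.1.2 → G.d (.inr e) ≤ (t'.val : ℤ) - (t.val : ℤ)
  exit_stays : ∀ (p : P) (t t' : Fin (tmax + 1)), t < t' →
    ∀ v ∈ G.EX, w t p = .inl v → w t' p = .inl v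

/-- Strong evacuation schedules: capacities of vertices and edges are respected, and everybody is
at an exit at time `tmax`. -/
structure IsSES (G : BuildingGraph V P) (s₀ : G.State) {tmax : ℕ}
    (w : Fin (tmax + 1) → G.State) : Prop extends IsWES G s₀ w where
  capacity : ∀ (t : Fin (tmax + 1)) (l : G.Loc), ({p | w t p = l}.ncard : ℤ) ≤ G.c l
  all_out : ∀ p : P, ∃ v ∈ G.EX, w (Fin.last tmax) p = .inl v

/-- The set of weak evacuation schedules. -/
abbrev WES (G : BuildingGraph V P) (s₀ : G.State) (tmax : ℕ) : Type :=
  {w : Fin (tmax + 1) → G.State // IsWES G s₀ w}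

/-- The set of strong evacuation schedules. -/
abbrev SES (G : BuildingGraph V P) (s₀ : G.State) (tmax : ℕ) : Type :=
  {w : Fin (tmax + 1) → G.State // IsSES G s₀ w}

noncomputable instance (G : BuildingGraph V P) (s₀ : G.State) (tmax : ℕ) :
    Fintype (WES G s₀ tmax) := Fintype.ofFinite _

/-- A behavior model assigns to each strong schedule a probability distribution on the weak
schedules. -/
abbrev BehaviorModel (G : BuildingGraph V P) (s₀ : G.State) (tmax : ℕ) : Type :=
  SES G s₀ tmax → stdSimplex ℝ (WES G s₀ tmax)

/-- The number of people evacuated by time `D`. -/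
noncomputable def numEvacuated (G : BuildingGraph V P) {tmax : ℕ}
    (w : Fin (tmax + 1) → G.State) (D : Fin (tmax + 1)) : ℕ :=
  {p : P | ∃ v ∈ G.EX, w D p = .inl v}.ncard

/-- The expected number of people evacuated by time `D` when the people are told to follow
`es`. -/
noncomputable def expectedEvacuated {G : BuildingGraph V P} {s₀ : G.State} {tmax : ℕ}
    (β : BehaviorModel G s₀ tmax) (D : Fin (tmax + 1)) (es : SES G s₀ tmax) : ℝ :=
  ∑ w : WES G s₀ tmax, (β es).1 w * (numEvacuated G w.1 D : ℝ)

end Framework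

/-- Evacuation frameworks with vertex set `V`, people `P` and time points `0, …, tmax`. -/
structure EvacuationFramework (V P : Type) [Fintype V] [Fintype P] (tmax : ℕ) where
  G : BuildingGraph V P
  s₀ : G.State
  β : BehaviorModel G s₀ tmax

/-! ## Encodings as bit strings

All encodings are uniquely decodable, given the numbers of vertices, people and time points. Sizes
of the explicitly given sets (vertices, people, time points), their elements, and step bounds are
in unary; capacities, travel times and probabilities are in binary. -/

def encUnary (k : ℕ) : List Bool := List.replicate k true ++ [false]

def encString (a : List Bool) : List Bool := a.flatMap (fun b => [true, b]) ++ [false]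

/-- Binary, least significant bit first. -/
def encNat (k : ℕ) : List Bool := encString k.bits

def encInt (z : ℤ) : List Bool := decide (z < 0) :: encNat z.natAbs

/-- A nonnegative rational number as a reduced fraction. -/
def encRat (q : ℚ≥0) : List Bool := encNat q.num ++ encNat q.den

def Prog.enc : Prog → List Bool
  | .skip => [false, false, false]
  | .push r b => [false, false, true] ++ encUnary r ++ [b]
  | .pop r => [false, true, false] ++ encUnary r
  | .seq p q => [false, true, true] ++ p.enc ++ q.enc
  | .branch r pn pf pt => [true, false, false] ++ encUnary r ++ pn.enc ++ pf.enc ++ pt.enc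
  | .loop r p => [true, false, true] ++ encUnary r ++ p.enc

/-- Concatenation of `f 0, …, f (k - 1)`. -/
def concatFin {k : ℕ} (f : Fin k → List Bool) : List Bool := (List.ofFn f).flatten

section Encodings

variable {n m : ℕ}

/-- For each vertex whether it is an exit, and its capacity; then the adjacency matrix, with
capacity and travel time of each edge. -/
def BuildingGraph.enc (G : BuildingGraph (Fin n) (Fin m)) : List Bool :=
  concatFin (fun v => decide (v ∈ G.EX) :: encInt (G.c (.inl v))) ++
  concatFin (fun u => concatFin (fun v =>
    if h : (u, v) ∈ G.E then
      true :: (encInt (G.c (.inr ⟨(u, v), h⟩)) ++ encInt (G.d (.inr ⟨(u, v), h⟩)))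
    else [false]))

def encLoc {G : BuildingGraph (Fin n) (Fin m)} : G.Loc → List Bool
  | .inl v => false :: encUnary v.val
  | .inr e => true :: (encUnary e.1.1.val ++ encUnary e.1.2.val)

def encState {G : BuildingGraph (Fin n) (Fin m)} (s : G.State) : List Bool :=
  concatFin (fun p => encLoc (s p))

def encSchedule {G : BuildingGraph (Fin n) (Fin m)} {tmax : ℕ}
    (w : Fin (tmax + 1) → G.State) : List Bool :=
  concatFin (fun t => encState (w t))

/-- A finite list of weak schedules with probabilities. -/
def encDistribution {G : BuildingGraph (Fin n) (Fin m)} {s₀ : G.State} {tmax : ℕ}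
    (l : List (WES G s₀ tmax × ℚ≥0)) : List Bool :=
  l.flatMap (fun a => true :: (encSchedule a.1.1 ++ encRat a.2)) ++ [false]

open Classical in
/-- The finite succinct description of a behavior model that is part of the input: a program with
a parameter string and a bound on its running time. On the parameter and any strong schedule `es`,
the program outputs within the bound the distribution `β es`, as a list of weak schedules with
their probabilities. -/
def Describes {G : BuildingGraph (Fin n) (Fin m)} {s₀ : G.State} {tmax : ℕ}
    (prog : Prog) (param : List Bool) (bound : ℕ) (β : BehaviorModel G s₀ tmax) : Prop :=
  ∀ es : SES G s₀ tmax, ∃ l : List (WES G s₀ tmax × ℚ≥0),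
    prog.OutputsWithin [param, encSchedule es.1] (encDistribution l) bound ∧
    ∀ w, (β es).1 w = ((((l.filter (fun a => a.1 = w)).map Prod.snd).sum : ℚ≥0) : ℝ)

end Encodings

/-! ## The evacuation problem -/

/-- Instances of EP: an evacuation framework, whose behavior model is given by a program, and
a deadline `D ≤ tmax`. -/
structure EPInstance where
  n : ℕ
  m : ℕ
  tmax : ℕ
  F : EvacuationFramework (Fin n) (Fin m) tmax
  D : Fin (tmax + 1)
  prog : Prog
  param : List Bool
  bound : ℕ
  describes : Describes prog param bound F.β

def EPInstance.enc (I : EPInstance) : List Bool :=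
  encUnary I.n ++ encUnary I.m ++ encUnary I.tmax ++ encUnary I.D.val ++
  I.F.G.enc ++ encState I.F.s₀ ++ I.prog.enc ++ encString I.param ++ encUnary I.bound

/-- The strong schedule `es` maximizes the expected number of people evacuated by `D`. -/
def EPInstance.IsOptimal (I : EPInstance) (es : SES I.F.G I.F.s₀ I.tmax) : Prop :=
  ∀ es' : SES I.F.G I.F.s₀ I.tmax,
    expectedEvacuated I.F.β I.D es' ≤ expectedEvacuated I.F.β I.D es

/-- The correct answers: any optimal strong schedule, or the report that there is no strong
schedule at all. -/
def EPInstance.IsAnswer (I : EPInstance) (y : List Bool) : Prop :=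
  (∃ es : SES I.F.G I.F.s₀ I.tmax, I.IsOptimal es ∧ y = true :: encSchedule es.1) ∨
  (IsEmpty (SES I.F.G I.F.s₀ I.tmax) ∧ y = [false])

/-- The Evacuation Problem. -/
def EP : SearchProblem where
  Inst := EPInstance
  encode := EPInstance.enc
  IsAnswer := EPInstance.IsAnswer

end Evac

/-! A person in a corridor can, at each time before leaving, stand at the entrance or on the edge to
the exit, so that schedules spell bit strings. Given an input `x` of a language in NP, let the
behavior model run the verifier on `x` and the string spelled by the schedule, and let the person
really leave exactly when the verifier accepts. If the last time point just leaves room for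
certificates of the admissible length, then an optimal schedule spells a certificate for `x` if
there is one, and a single run of the verifier on an optimal schedule decides membership.

The verifier fits into the instance because a behavior model is given by a program, whose time bound
is part of the instance in unary. -/

namespace Evac

namespace Prog

/-! ### Programs and their running times -/

/-- Started on the store `s`, the program `p` halts with the store `s'` after at most `T` steps. -/
def RunsWithin (p : Prog) (s s' : Store) (T : ℕ) : Prop := ∃ t ≤ T, p.Exec s s' t

lemma RunsWithin.mono {p : Prog} {s s' : Store} {T T' : ℕ} (h : p.RunsWithin s s' T)
    (hT : T ≤ T') : p.RunsWithin s s' T' :=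
  let ⟨t, ht, hp⟩ := h
  ⟨t, ht.trans hT, hp⟩

lemma RunsWithin.congr {p : Prog} {s s' u u' : Store} {T T' : ℕ} (h : p.RunsWithin u u' T)
    (hs : u = s) (hs' : u' = s') (hT : T ≤ T') : p.RunsWithin s s' T' :=
  hs ▸ hs' ▸ h.mono hT

lemma RunsWithin.outputsWithin {p : Prog} {inputs : List (List Bool)} {s : Store} {z : List Bool}
    {T : ℕ} (h : p.RunsWithin (initStore inputs) s T) (hz : s 0 = z) :
    p.OutputsWithin inputs z T :=
  let ⟨t, ht, hp⟩ := h
  ⟨s, t, ht, hp, hz⟩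

lemma runsWithin_skip (s : Store) : skip.RunsWithin s s 1 := ⟨1, le_rfl, .skip s⟩

lemma runsWithin_push (r : ℕ) (b : Bool) (s : Store) :
    (push r b).RunsWithin s (Function.update s r (b :: s r)) 1 := ⟨1, le_rfl, .push r b s⟩

lemma runsWithin_pop (r : ℕ) (s : Store) :
    (pop r).RunsWithin s (Function.update s r (s r).tail) 1 := ⟨1, le_rfl, .pop r s⟩

lemma RunsWithin.seq {p q : Prog} {s s' s'' : Store} {a b : ℕ} (hp : p.RunsWithin s s' a)
    (hq : q.RunsWithin s' s'' b) : (p.seq q).RunsWithin s s'' (a + b) :=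
  let ⟨t, ht, hp⟩ := hp
  let ⟨u, hu, hq⟩ := hq
  ⟨t + u, Nat.add_le_add ht hu, .seq hp hq⟩

lemma RunsWithin.branch_nil {r : ℕ} {pn pf pt : Prog} {s s' : Store} {T : ℕ}
    (h : pn.RunsWithin s s' T) (hr : s r = []) : (branch r pn pf pt).RunsWithin s s' (T + 1) :=
  let ⟨t, ht, hp⟩ := h
  ⟨t + 1, Nat.succ_le_succ ht, .branchNil hr hp⟩

lemma RunsWithin.branch_false {r : ℕ} {pn pf pt : Prog} {s s' : Store} {T : ℕ} {l : List Bool}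
    (h : pf.RunsWithin s s' T) (hr : s r = false :: l) :
    (branch r pn pf pt).RunsWithin s s' (T + 1) :=
  let ⟨t, ht, hp⟩ := h
  ⟨t + 1, Nat.succ_le_succ ht, .branchFalse (by rw [hr, List.head?_cons]) hp⟩

lemma RunsWithin.branch_true {r : ℕ} {pn pf pt : Prog} {s s' : Store} {T : ℕ} {l : List Bool}
    (h : pt.RunsWithin s s' T) (hr : s r = true :: l) :
    (branch r pn pf pt).RunsWithin s s' (T + 1) :=
  let ⟨t, ht, hp⟩ := h
  ⟨t + 1, Nat.succ_le_succ ht, .branchTrue (by rw [hr, List.head?_cons]) hp⟩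

/-- The store `F done todo` describes the machine when the items `done` have been processed and
the items `todo` are still to come. -/
lemma runsWithin_loop {β : Type*} {r : ℕ} {p : Prog} {T : ℕ} (F : List β → List β → Store)
    (hnil : ∀ done, F done [] r = []) (hcons : ∀ done x todo, F done (x :: todo) r ≠ [])
    (hp : ∀ done x todo, p.RunsWithin (F done (x :: todo)) (F (done ++ [x]) todo) T)
    (l : List β) : (loop r p).RunsWithin (F [] l) (F l []) (l.length * (T + 1) + 1) := by
  suffices h : ∀ todo done, (loop r p).RunsWithin (F done todo) (F (done ++ todo) [])
      (todo.length * (T + 1) + 1) from h l []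
  intro todo
  induction todo with
  | nil => exact fun done => ⟨1, by simp, by simpa using .loopDone (hnil done)⟩
  | cons x todo ih =>
    intro done
    obtain ⟨t, ht, hstep⟩ := hp done x todo
    obtain ⟨u, hu, hrest⟩ := ih (done ++ [x])
    refine ⟨t + u + 1, ?_, ?_⟩
    · rw [List.length_cons]
      linarith
    · rw [List.append_assoc] at hrest
      exact .loopStep (hcons done x todo) hstep hrest

/-- Run `p b` if `b` is the top of register `r`; do nothing if the register is empty. -/
def branchTop (r : ℕ) (p : Bool → Prog) : Prog := .branch r .skip (p false) (p true)

lemma RunsWithin.branchTop {r : ℕ} {p : Bool → Prog} {s s' : Store} {T : ℕ} {b : Bool}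
    {l : List Bool} (h : (p b).RunsWithin s s' T) (hr : s r = b :: l) :
    (branchTop r p).RunsWithin s s' (T + 1) := by
  cases b
  · exact h.branch_false hr
  · exact h.branch_true hr

/-- Push the bits of `l`, its first bit last. -/
def pushList (r : ℕ) : List Bool → Prog
  | [] => .skip
  | b :: l => .seq (pushList r l) (.push r b)

lemma runsWithin_pushList (r : ℕ) (l : List Bool) (s : Store) :
    (pushList r l).RunsWithin s (Function.update s r (l ++ s r)) (l.length + 1) := by
  induction l with
  | nil => exact (runsWithin_skip s).congr rfl (by simp) (by simp)
  | cons b l ih => exact (ih.seq (runsWithin_push r b _)).congr rfl (by simp) (by simp)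

/-- Empty register `a` onto register `b`, which reverses its content. -/
def move (a b : ℕ) : Prog := .loop a (.seq (branchTop a (.push b)) (.pop a))

lemma runsWithin_move {a b : ℕ} (hab : a ≠ b) (s : Store) :
    (move a b).RunsWithin s (Function.update (Function.update s a []) b ((s a).reverse ++ s b))
      (4 * (s a).length + 1) := by
  have hloop := runsWithin_loop (r := a) (p := .seq (branchTop a (.push b)) (.pop a)) (T := 3)
    (fun moved rest => Function.update (Function.update s a rest) b (moved.reverse ++ s b))
    (by simp [hab]) (by simp [hab])
    (fun moved x rest => (((runsWithin_push b x _).branchTop (l := rest) (by simp [hab])).seq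
      (runsWithin_pop a _)).congr rfl
        (by simp [hab, Function.update_comm hab.symm]) le_rfl)
    (s a)
  exact hloop.congr (by simp) rfl (by omega)

/-- Push onto register `dst` the bits `g b`, where `b` runs through register `src`. Register `tmp`
is used to restore `src`. -/
def appendFlatMap (g : Bool → List Bool) (src dst tmp : ℕ) : Prog :=
  .seq (move src tmp) (.loop tmp (.seq (branchTop tmp (.push src))
    (.seq (branchTop tmp fun b => pushList dst (g b)) (.pop tmp))))

lemma runsWithin_appendFlatMap {g : Bool → List Bool} {k : ℕ} (hg : ∀ b, (g b).length ≤ k)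
    {src dst tmp : ℕ} (hsd : src ≠ dst) (hst : src ≠ tmp) (hdt : dst ≠ tmp) {s : Store}
    (hs : s tmp = []) :
    (appendFlatMap g src dst tmp).RunsWithin s
      (Function.update s dst ((s src).flatMap g ++ s dst)) ((s src).length * (k + 10) + 2) := by
  have hloop := runsWithin_loop (r := tmp) (T := k + 5)
    (p := .seq (branchTop tmp (.push src))
      (.seq (branchTop tmp fun b => pushList dst (g b)) (.pop tmp)))
    (fun copied rest => Function.update (Function.update (Function.update s tmp rest)
      src copied.reverse) dst (copied.reverse.flatMap g ++ s dst))
    (by simp [hst.symm, hdt.symm]) (by simp [hst.symm, hdt.symm])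
    (fun copied b rest => (((runsWithin_push src b _).branchTop (l := rest) (b := b)
      (by simp [hst.symm, hdt.symm])).seq (((runsWithin_pushList dst (g b) _).branchTop (b := b)
      (p := fun b => pushList dst (g b)) (l := rest) (by simp [hst.symm, hdt.symm])).seq
      (runsWithin_pop tmp _))).congr rfl (by
        funext r
        simp only [Function.update_apply]
        split_ifs <;> simp_all) (by have := hg b; omega))
    (s src).reverse
  refine ((runsWithin_move hst s).seq (hloop.congr ?_ rfl le_rfl)).congr rfl ?_ ?_
  · simp [hs, hsd.symm, hdt, Function.update_comm hst.symm]
  · simp [hs.symm]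
  · rw [List.length_reverse]
    linarith

/-- Push onto register `k` whether register `r` contains `[true]`. -/
def pushAccepts (r k : ℕ) : Prog :=
  .branch r (.push k false) (.push k false)
    (.seq (.pop r) (.branch r (.push k true) (.push k false) (.push k false)))

lemma exists_runsWithin_pushAccepts {r k : ℕ} (hrk : r ≠ k) (s : Store) :
    ∃ l, (pushAccepts r k).RunsWithin s
      (Function.update (Function.update s r l) k (decide (s r = [true]) :: s k)) 4 := by
  have hpush (b : Bool) (l : List Bool) : (push k b).RunsWithin (Function.update s r l)
      (Function.update (Function.update s r l) k (b :: s k)) 1 :=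
    (runsWithin_push k b _).congr rfl (by simp [hrk.symm]) le_rfl
  rcases h : s r with _ | ⟨b, l⟩
  · exact ⟨s r, (((hpush false (s r)).congr (by simp) rfl le_rfl).branch_nil h).mono (by simp)⟩
  cases b
  · exact ⟨s r, (((hpush false (s r)).congr (by simp) rfl le_rfl).branch_false h).mono (by simp)⟩
  have hpop : (pop r).RunsWithin s (Function.update s r l) 1 := by
    simpa [h] using runsWithin_pop r s
  refine ⟨l, ((hpop.seq (b := 2) ?_).branch_true h).mono (by simp)⟩
  rcases l with _ | ⟨_ | _, l⟩
  · exact (hpush true []).branch_nil (by simp)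
  · exact (hpush false (false :: l)).branch_false (l := l) (by simp)
  · exact (hpush false (true :: l)).branch_true (l := l) (by simp)

/-- Replace every register `r` by `f r`. -/
def rename (f : ℕ → ℕ) : Prog → Prog
  | .skip => .skip
  | .push r b => .push (f r) b
  | .pop r => .pop (f r)
  | .seq p q => .seq (p.rename f) (q.rename f)
  | .branch r pn pf pt => .branch (f r) (pn.rename f) (pf.rename f) (pt.rename f)
  | .loop r p => .loop (f r) (p.rename f)

lemma extend_update {α β γ : Type*} [DecidableEq α] [DecidableEq β] {f : α → β}
    (hf : f.Injective) (s : α → γ) (u : β → γ) (r : α) (l : γ) :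
    Function.extend f (Function.update s r l) u =
      Function.update (Function.extend f s u) (f r) l := by
  funext i
  by_cases hi : ∃ j, f j = i
  · obtain ⟨j, rfl⟩ := hi
    simp only [hf.extend_apply, Function.update_apply, hf.eq_iff]
  · have hne : i ≠ f r := fun h => hi ⟨r, h.symm⟩
    rw [Function.update_of_ne hne, Function.extend_apply' _ _ _ hi, Function.extend_apply' _ _ _ hi]

lemma Exec.rename {f : ℕ → ℕ} (hf : f.Injective) (u : Store) {p : Prog} {s s' : Store} {t : ℕ}
    (h : p.Exec s s' t) :
    (p.rename f).Exec (Function.extend f s u) (Function.extend f s' u) t := by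
  have hget (s : Store) (r : ℕ) : Function.extend f s u (f r) = s r := hf.extend_apply ..
  induction h with
  | skip s => exact .skip _
  | push r b s =>
    have hpush := Exec.push (f r) b (Function.extend f s u)
    rwa [hget, ← extend_update hf] at hpush
  | pop r s =>
    have hpop := Exec.pop (f r) (Function.extend f s u)
    rwa [hget, ← extend_update hf] at hpop
  | seq _ _ ihp ihq => exact .seq ihp ihq
  | branchNil hr _ ih => exact .branchNil ((hget _ _).trans hr) ih
  | branchFalse hr _ ih => exact .branchFalse (by rwa [hget]) ih
  | branchTrue hr _ ih => exact .branchTrue (by rwa [hget]) ih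
  | loopDone hr => exact .loopDone ((hget _ _).trans hr)
  | loopStep hr _ _ ihp ihl => exact .loopStep (by rwa [hget]) ihp ihl

end Prog

lemma initStore_apply (l : List (List Bool)) (r : ℕ) : initStore l r = l.getD r [] := rfl

lemma update_initStore {l : List (List Bool)} {r : ℕ} (hr : r < l.length) (a : List Bool) :
    Function.update (initStore l) r a = initStore (l.set r a) := by
  funext i
  rcases eq_or_ne i r with rfl | hi
  · simp [initStore, hr]
  · simp [initStore, hi, hi.symm]

lemma initStore_append_replicate_nil (l : List (List Bool)) (k : ℕ) :
    initStore (l ++ List.replicate k []) = initStore l := by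
  funext i
  rcases lt_or_ge i l.length with hi | hi
  · simp [initStore, hi, List.getElem?_append_left]
  · simp [initStore, hi, List.getElem?_append_right, List.getElem?_getD_replicate_default_eq]

/-! ### Writing polynomial-size data -/

/-- Horner's rule makes do with the same few registers for all degrees. -/
lemma exists_prog_eval (q : Polynomial ℕ) : ∃ (p : Prog) (τ : Polynomial ℕ),
    ∀ (n : ℕ) (a b : List Bool), p.RunsWithin
      (initStore [a, b, List.replicate n true, [], [], []])
      (initStore [a, b, List.replicate n true, List.replicate (q.eval n) true, [], []])
      (τ.eval n) := by
  induction q using Polynomial.recOnHorner with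
  | M0 => exact ⟨.skip, 1, fun n a b => by simpa using Prog.runsWithin_skip _⟩
  | MC q k _ _ ih =>
    obtain ⟨p, τ, hp⟩ := ih
    refine ⟨.seq p (Prog.pushList 3 (List.replicate k true)), τ + (Polynomial.C (k + 1)),
      fun n a b => ((hp n a b).seq (Prog.runsWithin_pushList _ _ _)).congr rfl ?_ (by simp)⟩
    simp [update_initStore, initStore_apply, add_comm _ k]
  | MX q _ ih =>
    obtain ⟨p, τ, hp⟩ := ih
    refine ⟨.seq p (.seq (.loop 3 (.seq (.pop 3) (Prog.appendFlatMap (fun b => [b]) 2 4 5)))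
      (Prog.move 4 3)),
      τ + (q * (1 + (Polynomial.X * 11 + 2) + 1) + 1 + (4 * (q * Polynomial.X) + 1)),
      fun n a b => ?_⟩
    have hloop := Prog.runsWithin_loop (r := 3) (T := 1 + (n * (1 + 10) + 2))
      (p := .seq (.pop 3) (Prog.appendFlatMap (fun b => [b]) 2 4 5))
      (fun added rest => initStore [a, b, List.replicate n true, rest,
        List.replicate (added.length * n) true, []])
      (fun _ => rfl) (fun _ _ _ => List.cons_ne_nil _ _)
      (fun added c rest => ((Prog.runsWithin_pop 3 _).seq (Prog.runsWithin_appendFlatMap (k := 1)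
        (fun _ => le_rfl) (by norm_num) (by norm_num) (by norm_num)
        (by simp [initStore_apply]))).congr rfl
          (by simp [update_initStore, initStore_apply, add_mul, add_comm _ n])
          (by simp [initStore_apply]))
      (List.replicate (q.eval n) true)
    refine ((hp n a b).seq ((hloop.congr (by simp) rfl le_rfl).seq
      (Prog.runsWithin_move (a := 4) (b := 3) (by norm_num) _))).congr rfl ?_ ?_
    · simp [update_initStore, initStore_apply]
    · simp [initStore_apply]

/-- The store with the output `out` written so far in register `0`, next to the input `x`, its
length in unary, and empty working registers. -/
def writerStore (out x : List Bool) : Store :=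
  initStore [out, x, List.replicate x.length true, [], [], []]

/-- Some program writes `f x` in front of the output in time polynomial in `x.length`, and leaves
everything else as it was. Such programs compose, so that this property, unlike `PolyTime`, is
evidently closed under concatenation. -/
def PolyWritable (f : List Bool → List Bool) : Prop :=
  ∃ (p : Prog) (τ : Polynomial ℕ), ∀ x out,
    p.RunsWithin (writerStore out x) (writerStore (f x ++ out) x) (τ.eval x.length)

namespace PolyWritable

lemma const (a : List Bool) : PolyWritable fun _ => a :=
  ⟨Prog.pushList 0 a, Polynomial.C (a.length + 1), fun x out =>
    (Prog.runsWithin_pushList 0 a _).congr rfl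
      (by simp [writerStore, update_initStore, initStore_apply]) (by simp)⟩

lemma append {f g : List Bool → List Bool} (hf : PolyWritable f) (hg : PolyWritable g) :
    PolyWritable fun x => f x ++ g x := by
  obtain ⟨p, τ, hp⟩ := hf
  obtain ⟨p', τ', hp'⟩ := hg
  exact ⟨.seq p' p, τ' + τ, fun x out =>
    ((hp' x out).seq (hp x _)).congr rfl (by rw [List.append_assoc]) (by simp)⟩

lemma flatMap (g : Bool → List Bool) : PolyWritable fun x => x.flatMap g := by
  obtain ⟨k, hk⟩ : ∃ k, ∀ b, (g b).length ≤ k :=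
    ⟨_, fun b => Finset.le_sup (f := fun b => (g b).length) (Finset.mem_univ b)⟩
  exact ⟨Prog.appendFlatMap g 1 0 3, Polynomial.X * Polynomial.C (k + 10) + 2, fun x out =>
    (Prog.runsWithin_appendFlatMap hk (by norm_num) (by norm_num) (by norm_num) rfl).congr rfl
      (by simp [writerStore, update_initStore, initStore_apply])
      (by simp [writerStore, initStore_apply])⟩

lemma replicate_eval (q : Polynomial ℕ) :
    PolyWritable fun x => List.replicate (q.eval x.length) true := by
  obtain ⟨p, τ, hp⟩ := exists_prog_eval q
  exact ⟨.seq p (Prog.move 3 0), τ + (4 * q + 1), fun x out =>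
    ((hp x.length out x).seq (Prog.runsWithin_move (by norm_num) _)).congr rfl
      (by simp [writerStore, update_initStore, initStore_apply])
      (by simp [initStore_apply])⟩

lemma encString : PolyWritable encString := (flatMap _).append (const [false])

lemma encUnary_eval (q : Polynomial ℕ) : PolyWritable fun x => encUnary (q.eval x.length) :=
  (replicate_eval q).append (const [false])

lemma polyTime {f : List Bool → List Bool} (hf : PolyWritable f) : PolyTime f := by
  obtain ⟨p, τ, hp⟩ := hf
  refine ⟨.seq (.seq (Prog.move 0 3) (.seq (Prog.move 3 1)
    (Prog.appendFlatMap (fun _ => [true]) 1 2 3))) p, 19 * Polynomial.X + 4 + τ, fun x => ?_⟩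
  have hlength : x.flatMap (fun _ => [true]) = List.replicate x.length true := by
    rw [← List.map_eq_flatMap, List.map_const']
  have hprepare : (Prog.seq (Prog.move 0 3) (.seq (Prog.move 3 1)
      (Prog.appendFlatMap (fun _ => [true]) 1 2 3))).RunsWithin (initStore [x])
      (writerStore [] x) (19 * x.length + 4) := by
    rw [← initStore_append_replicate_nil [x] 5]
    refine ((Prog.runsWithin_move (by norm_num) _).seq ((Prog.runsWithin_move (by norm_num) _).seq
      (Prog.runsWithin_appendFlatMap (k := 1) (fun _ => le_rfl) (by norm_num) (by norm_num)
        (by norm_num) ?_))).congr rfl ?_ ?_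
    · simp [update_initStore, initStore_apply]
    · simp [writerStore, update_initStore, initStore_apply, hlength]
    · simp +arith [update_initStore, initStore_apply]
  exact ((hprepare.seq (hp x [])).mono (by simp)).outputsWithin (List.append_nil (f x))

end PolyWritable

/-! ### Optimal schedules and deterministic behavior -/

lemma EPInstance.exists_isAnswer (I : EPInstance) : ∃ y, I.IsAnswer y := by
  rcases isEmpty_or_nonempty (SES I.F.G I.F.s₀ I.tmax) with hnone | _
  · exact ⟨_, .inr ⟨hnone, rfl⟩⟩
  · obtain ⟨es, hes⟩ := Finite.exists_max (expectedEvacuated I.F.β I.D)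
    exact ⟨_, .inl ⟨es, hes, rfl⟩⟩

section Deterministic

variable {V P : Type} [Fintype V] [Fintype P] {G : BuildingGraph V P} {s₀ : G.State} {tmax : ℕ}

open Classical in
/-- The behavior model in which the people who are told to follow `es` certainly follow `g es`. -/
noncomputable def deterministicModel (g : SES G s₀ tmax → WES G s₀ tmax) :
    BehaviorModel G s₀ tmax :=
  fun es => ⟨Pi.single (g es) 1, single_mem_stdSimplex ℝ _⟩

lemma expectedEvacuated_deterministicModel (g : SES G s₀ tmax → WES G s₀ tmax)
    (D : Fin (tmax + 1)) (es : SES G s₀ tmax) :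
    expectedEvacuated (deterministicModel g) D es = numEvacuated G (g es).1 D := by
  classical
  rw [expectedEvacuated, Finset.sum_eq_single (g es)]
  · simp [deterministicModel]
  · simp +contextual [deterministicModel]
  · simp

lemma describes_deterministicModel {n m : ℕ} {G : BuildingGraph (Fin n) (Fin m)} {s₀ : G.State}
    {p : Prog} {param : List Bool} {T : ℕ} {g : SES G s₀ tmax → WES G s₀ tmax}
    (h : ∀ es, p.OutputsWithin [param, encSchedule es.1] (encDistribution [(g es, 1)]) T) :
    Describes p param T (deterministicModel g) := by
  classical
  refine fun es => ⟨_, h es, fun w => ?_⟩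
  by_cases hw : g es = w
  · simp [deterministicModel, hw]
  · simp [deterministicModel, hw, Ne.symm hw]

end Deterministic

/-! ### Schedules that spell bit strings -/

/-- The building in which a single person can walk from the vertex `0` to the exit `1`. Its edge
has travel time `1`, so that the person may also stay on the edge for a while. -/
def corridor : BuildingGraph (Fin 2) (Fin 1) where
  E := {(0, 1)}
  EX := {1}
  EX_ssubset := by decide
  c := fun _ => 1
  d := Sum.elim (fun _ => 0) (fun _ => 1)
  d_vertex := fun _ => rfl
  c_exit := fun _ _ => by simp

/-- The only edge of the corridor. -/
def corridorEdge : corridor.E := ⟨(0, 1), by simp [corridor]⟩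

lemma eq_corridorEdge (e : corridor.E) : e = corridorEdge :=
  Subtype.ext (Finset.mem_singleton.1 e.2)

lemma corridor_loc_cases (l : corridor.Loc) :
    l = .inl 0 ∨ l = .inl 1 ∨ l = .inr corridorEdge := by
  rcases l with v | e
  · fin_cases v <;> simp
  · simp [eq_corridorEdge e]

lemma mem_corridor_EX {v : Fin 2} : v ∈ corridor.EX ↔ v = 1 := by simp [corridor]

/-- The initial state of the corridor. -/
def corridorStart : corridor.State := fun _ => .inl 0

variable {tmax N : ℕ}

lemma isWES_corridor {w : Fin (tmax + 1) → corridor.State} (hstart : w 0 = corridorStart)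
    (hexit : ∀ p t t', t < t' → w t p = .inl 1 → w t' p = .inl 1) :
    IsWES corridor corridorStart w where
  start := hstart
  from_vertex p t v hv := by
    fin_cases v
    · rcases corridor_loc_cases (w t.succ p) with h | h | h
      · exact .inl h
      · exact .inr (.inr ⟨corridorEdge, rfl, h⟩)
      · exact .inr (.inl ⟨corridorEdge, rfl, h⟩)
    · exact .inl (hexit p _ _ Fin.castSucc_lt_succ hv)
  from_edge p t e _ := by
    rw [eq_corridorEdge e]
    rcases corridor_loc_cases (w t.succ p) with h | h | h
    · exact .inr (.inl h)
    · exact .inr (.inr h)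
    · exact .inl h
  travel p e t t' htt' h h' := by
    rw [eq_corridorEdge e] at h h'
    have hne : t ≠ t' := by
      rintro rfl
      simp [h, corridorEdge] at h'
    have hlt : t.val < t'.val := lt_of_le_of_ne htt' (Fin.val_ne_of_ne hne)
    change (1 : ℤ) ≤ _
    omega
  exit_stays p t t' htt' v hv h := by
    obtain rfl := mem_corridor_EX.1 hv
    exact hexit p t t' htt' h

lemma isSES_corridor {w : Fin (tmax + 1) → corridor.State} (hw : IsWES corridor corridorStart w)
    (hlast : ∀ p, w (Fin.last tmax) p = .inl 1) : IsSES corridor corridorStart w where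
  toIsWES := hw
  capacity t l := by
    have hcard : {p | w t p = l}.ncard ≤ 1 := Set.ncard_le_one_of_subsingleton _
    change _ ≤ (1 : ℤ)
    exact_mod_cast hcard
  all_out p := ⟨1, mem_corridor_EX.2 rfl, hlast p⟩

/-- The bit spelled by a location: `false` by the vertex `0` and `true` by the edge. The exit
spells nothing. -/
def locBit : corridor.Loc → Option Bool
  | .inl v => if v = 0 then some false else none
  | .inr _ => some true

/-- The location that spells a given bit. -/
def bitLoc (b : Bool) : corridor.Loc := if b then .inr corridorEdge else .inl 0

lemma locBit_bitLoc (b : Bool) : locBit (bitLoc b) = some b := by cases b <;> rfl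

lemma bitLoc_ne_exit (b : Bool) : bitLoc b ≠ .inl 1 := by cases b <;> simp [bitLoc]

/-- The bit string spelled by a schedule. Time `0` is skipped, since the initial state is not up to
the schedule. -/
def spelled (w : Fin (tmax + 1) → corridor.State) : List Bool :=
  (List.ofFn fun t : Fin tmax => w t.succ 0).filterMap locBit

lemma length_spelled_le (w : Fin (tmax + 1) → corridor.State) : (spelled w).length ≤ tmax :=
  (List.length_filterMap_le _ _).trans_eq (List.length_ofFn)

lemma length_spelled_le_of_ses (es : SES corridor corridorStart (N + 1)) :
    (spelled es.1).length ≤ N := by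
  obtain ⟨v, hv, hlast⟩ := es.2.all_out 0
  obtain rfl := mem_corridor_EX.1 hv
  have hexit : locBit (es.1 (Fin.last N).succ 0) = none := by
    rw [Fin.succ_last, hlast]
    rfl
  rw [spelled, List.ofFn_succ', List.concat_eq_append, List.filterMap_append,
    List.filterMap_cons_none hexit, List.filterMap_nil, List.append_nil]
  exact (List.length_filterMap_le _ _).trans_eq List.length_ofFn

/-- The location at time `t` of a person who spells `c` and then leaves. -/
def spellingLoc (c : List Bool) : ℕ → corridor.Loc
  | 0 => .inl 0
  | t + 1 => (c.map bitLoc).getD t (.inl 1)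

lemma spellingLoc_eq_exit {c : List Bool} {t : ℕ} : spellingLoc c t = .inl 1 ↔ c.length < t := by
  cases t with
  | zero => simp [spellingLoc]
  | succ t =>
    rcases lt_or_ge t c.length with h | h
    · simp [spellingLoc, bitLoc_ne_exit, h]
    · simp [spellingLoc, h, Nat.lt_succ_of_le h]

lemma ofFn_spellingLoc {c : List Bool} (hc : c.length ≤ tmax) :
    (List.ofFn fun t : Fin tmax => spellingLoc c (t + 1)) =
      c.map bitLoc ++ List.replicate (tmax - c.length) (.inl 1) := by
  refine List.ext_getElem (by simp [hc]) fun t _ _ => ?_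
  rcases lt_or_ge t c.length with h | h
  · simp [spellingLoc, h]
  · simp [spellingLoc, h, List.getElem_append_right]

lemma exists_ses_spelled_eq {c : List Bool} (hc : c.length ≤ N) :
    ∃ es : SES corridor corridorStart (N + 1), spelled es.1 = c := by
  refine ⟨⟨fun t _ => spellingLoc c t, isSES_corridor (isWES_corridor rfl ?_) ?_⟩, ?_⟩
  · intro _ t t' htt' h
    rw [spellingLoc_eq_exit] at h ⊢
    exact h.trans htt'
  · exact fun _ => spellingLoc_eq_exit.2 (Nat.lt_succ_of_le hc)
  · have hexit : locBit (.inl 1) = none := rfl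
    change (List.ofFn fun t : Fin (N + 1) => spellingLoc c (t + 1)).filterMap locBit = c
    simp [-List.ofFn_succ, ofFn_spellingLoc (hc.trans N.le_succ), List.filterMap_map,
      locBit_bitLoc, hexit]

/-! ### Rewarding accepted certificates -/

/-- Where the person is after time `0`, according to a verdict on the schedule. -/
def verdictLoc (b : Bool) : corridor.Loc := .inl (if b then 1 else 0)

/-- The person walks to the exit at once if the verdict `b` is positive, and stays at the vertex `0`
forever otherwise. -/
def verdictSchedule (tmax : ℕ) (b : Bool) : WES corridor corridorStart tmax :=
  ⟨fun t _ => if t = 0 then .inl 0 else verdictLoc b, isWES_corridor rfl fun _ t t' htt' h => by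
    rw [if_neg (Fin.ne_zero_of_lt htt')]
    split_ifs at h
    · simp at h
    · exact h⟩

lemma numEvacuated_verdictSchedule (b : Bool) {D : Fin (tmax + 1)} (hD : D ≠ 0) :
    numEvacuated corridor (verdictSchedule tmax b).1 D = if b then 1 else 0 := by
  cases b <;> simp [numEvacuated, verdictSchedule, verdictLoc, mem_corridor_EX, hD]

/-- The person who is told to follow a schedule leaves the building if the spelled string is
accepted, and ignores the schedule otherwise. -/
noncomputable def verdictModel (tmax : ℕ) (accepts : List Bool → Bool) :
    BehaviorModel corridor corridorStart tmax :=
  deterministicModel fun es => verdictSchedule tmax (accepts (spelled es.1))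

lemma expectedEvacuated_verdictModel (accepts : List Bool → Bool) {D : Fin (tmax + 1)} (hD : D ≠ 0)
    (es : SES corridor corridorStart tmax) :
    expectedEvacuated (verdictModel tmax accepts) D es =
      if accepts (spelled es.1) then 1 else 0 := by
  rw [verdictModel, expectedEvacuated_deterministicModel, numEvacuated_verdictSchedule _ hD,
    Nat.cast_ite, Nat.cast_one, Nat.cast_zero]

lemma accepts_spelled_iff_exists {accepts : List Bool → Bool} {D : Fin (N + 2)} (hD : D ≠ 0)
    {es : SES corridor corridorStart (N + 1)}
    (hes : ∀ es', expectedEvacuated (verdictModel (N + 1) accepts) D es' ≤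
      expectedEvacuated (verdictModel (N + 1) accepts) D es) :
    accepts (spelled es.1) ↔ ∃ c : List Bool, c.length ≤ N ∧ accepts c := by
  refine ⟨fun h => ⟨_, length_spelled_le_of_ses es, h⟩, ?_⟩
  rintro ⟨c, hc, haccepts⟩
  obtain ⟨es', rfl⟩ := exists_ses_spelled_eq hc
  by_contra hrejects
  have hle := hes es'
  rw [expectedEvacuated_verdictModel accepts hD, expectedEvacuated_verdictModel accepts hD,
    if_pos haccepts, if_neg hrejects] at hle
  exact absurd hle (by norm_num)

/-! ### Encodings of schedules -/

lemma encSchedule_corridor (w : Fin (tmax + 1) → corridor.State) :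
    encSchedule w =
      encLoc (w 0 0) ++ (List.ofFn fun t : Fin tmax => w t.succ 0).flatMap encLoc := by
  have hstate (s : corridor.State) : encState s = encLoc (s 0) := by simp [encState, concatFin]
  simp [encSchedule, concatFin, hstate, List.ofFn_succ, List.flatMap_def, Function.comp_def]

/-- What follows the schedule in the encoding of a point distribution. -/
def distributionTail : List Bool := encRat 1 ++ [false]

lemma length_distributionTail : distributionTail.length = 7 := by
  simp [distributionTail, encRat, encNat, encString]

lemma encDistribution_verdictSchedule (tmax : ℕ) (b : Bool) :
    encDistribution [(verdictSchedule tmax b, 1)] =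
      true :: encLoc (corridorStart 0) ++
        ((List.replicate tmax true).flatMap (fun _ => encLoc (verdictLoc b)) ++
          distributionTail) := by
  simp [encDistribution, encSchedule_corridor, verdictSchedule, distributionTail, corridorStart,
    List.flatMap_def, Function.comp_def]

/-! ### The programs -/

namespace Prog

/-- Read one location of the corridor from register `1`, count it in register `2`, and push the bit
that it spells, if any, onto register `3`. -/
def readLoc : Prog :=
  .seq (branchTop 1 fun
    | false => .seq (.pop 1) (branchTop 1 fun
      | false => .seq (.pop 1) (.push 3 false)
      | true => .seq (.pop 1) (.pop 1))
    | true => .seq (.pop 1) (.seq (.pop 1) (.seq (.pop 1) (.seq (.pop 1) (.push 3 true)))))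
  (.push 2 true)

lemma runsWithin_readLoc (l : corridor.Loc) (code count bits x : List Bool) :
    readLoc.RunsWithin (initStore [[], encLoc l ++ code, count, bits, x, []])
      (initStore [[], code, true :: count, (locBit l).toList ++ bits, x, []]) 7 := by
  have hpop (b : Bool) (code : List Bool) : (Prog.pop 1).RunsWithin
      (initStore [[], b :: code, count, bits, x, []])
      (initStore [[], code, count, bits, x, []]) 1 :=
    (runsWithin_pop 1 _).congr rfl (by simp [update_initStore, initStore_apply]) le_rfl
  have hpush (b : Bool) : (Prog.push 3 b).RunsWithin
      (initStore [[], code, count, bits, x, []])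
      (initStore [[], code, count, b :: bits, x, []]) 1 :=
    (runsWithin_push 3 b _).congr rfl (by simp [update_initStore, initStore_apply]) le_rfl
  have hcount (bits : List Bool) : (Prog.push 2 true).RunsWithin
      (initStore [[], code, count, bits, x, []])
      (initStore [[], code, true :: count, bits, x, []]) 1 :=
    (runsWithin_push 2 true _).congr rfl (by simp [update_initStore, initStore_apply]) le_rfl
  refine RunsWithin.seq (a := 6) ?_ (hcount _)
  rcases corridor_loc_cases l with rfl | rfl | rfl
  · exact (((hpop false (false :: code)).seq
      (((hpop false code).seq (hpush false)).branchTop rfl)).branchTop rfl).mono (by norm_num)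
  · exact (((hpop false (true :: false :: code)).seq
      (((hpop true (false :: code)).seq (hpop false code)).branchTop rfl)).branchTop rfl).mono
        (by norm_num)
  · exact ((hpop true (false :: true :: false :: code)).seq ((hpop _ _).seq
      ((hpop _ _).seq ((hpop _ _).seq (hpush true))))).branchTop rfl

/-- From an input `x` and the encoding of a schedule, compute the string spelled by the schedule,
next to `x` in register `5`, and the number of time points after `0`, in unary in register `2`. -/
def spell : Prog :=
  .seq (move 0 3) (.seq (move 3 4) (.seq (.pop 1) (.seq (.pop 1)
    (.seq (.loop 1 readLoc) (move 3 5)))))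

lemma runsWithin_spell (x : List Bool) {w : Fin (tmax + 1) → corridor.State}
    (hw : w 0 = corridorStart) :
    spell.RunsWithin (initStore [x, encSchedule w])
      (initStore [[], [], List.replicate tmax true, [], x, spelled w])
      (8 * x.length + 12 * tmax + 6) := by
  set locs := List.ofFn fun t : Fin tmax => w t.succ 0 with hlocs
  have hlength : locs.length = tmax := List.length_ofFn
  have hcode : encSchedule w = false :: false :: locs.flatMap encLoc := by
    rw [encSchedule_corridor, hw]
    rfl
  have hloop := runsWithin_loop (r := 1) (p := readLoc) (T := 7)
    (fun done todo => initStore [[], todo.flatMap encLoc, List.replicate done.length true,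
      (done.filterMap locBit).reverse, x, []])
    (fun _ => rfl)
    (fun _ l _ => by rcases l with _ | _ <;> simp [initStore_apply, encLoc])
    (fun done l todo => (runsWithin_readLoc l _ _ _ x).congr rfl
      (by cases h : locBit l <;> simp [h, List.replicate_succ, List.flatMap_def]) le_rfl)
    locs
  rw [← initStore_append_replicate_nil [x, encSchedule w] 4, hcode]
  refine ((runsWithin_move (by norm_num) _).seq ((runsWithin_move (by norm_num) _).seq
    ((runsWithin_pop 1 _).seq ((runsWithin_pop 1 _).seq ((hloop.congr ?_ rfl le_rfl).seq
      (runsWithin_move (by norm_num) _)))))).congr rfl ?_ ?_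
  · simp [update_initStore, initStore_apply]
  · simp [update_initStore, initStore_apply, spelled, hlocs]
  · have hspelled : (locs.filterMap locBit).length ≤ tmax := length_spelled_le w
    simp +arith [update_initStore, initStore_apply, hlength, hspelled]

/-- Run the verifier `v` on an input and the string spelled by a schedule, in registers of its own,
and put the verdict into register `3`. -/
def verifySpelled (v : Prog) : Prog :=
  .seq spell (.seq (v.rename (· + 4)) (pushAccepts 4 3))

variable {v : Prog} {x z : List Bool} {T : ℕ} {w : Fin (tmax + 1) → corridor.State}

lemma exists_runsWithin_verifySpelled (hw : w 0 = corridorStart)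
    (hv : v.OutputsWithin [x, spelled w] z T) :
    ∃ s : Store, v.verifySpelled.RunsWithin (initStore [x, encSchedule w]) s
        (T + 8 * x.length + 12 * tmax + 10) ∧
      s 0 = [] ∧ s 1 = [] ∧ s 2 = List.replicate tmax true ∧ s 3 = [decide (z = [true])] := by
  obtain ⟨s, t, ht, hexec, hz⟩ := hv
  have hinj : Function.Injective (· + 4 : ℕ → ℕ) := add_left_injective 4
  set u : Store := initStore [[], [], List.replicate tmax true]
  have hstart : Function.extend (· + 4) (initStore [x, spelled w]) u =
      initStore [[], [], List.replicate tmax true, [], x, spelled w] := by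
    funext r
    rcases r with _ | _ | _ | _ | r
    case succ.succ.succ.succ => exact hinj.extend_apply _ _ r
    all_goals exact Function.extend_apply' _ _ _ (by simp)
  have hrename : (v.rename (· + 4)).RunsWithin _ _ T := ⟨t, ht, hexec.rename hinj u⟩
  have hverdict : Function.extend (· + 4) s u 4 = z := (hinj.extend_apply s u 0).trans hz
  obtain ⟨l, haccepts⟩ := exists_runsWithin_pushAccepts (r := 4) (k := 3) (by norm_num)
    (Function.extend (· + 4) s u)
  refine ⟨_, ((runsWithin_spell x hw).seq ((hrename.congr hstart rfl le_rfl).seq haccepts)).mono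
    (by omega), ?_, ?_, ?_, ?_⟩
  all_goals simp [hverdict, u, initStore_apply]

/-- The program for `verdictModel`, where `v` decides which strings are accepted. -/
def behavior (v : Prog) : Prog :=
  .seq v.verifySpelled (branchTop 3 fun b =>
    .seq (pushList 0 distributionTail)
      (.seq (appendFlatMap (fun _ => encLoc (verdictLoc b)) 2 0 1)
        (pushList 0 (true :: encLoc (corridorStart 0)))))

lemma behavior_outputsWithin (hw : w 0 = corridorStart)
    (hv : v.OutputsWithin [x, spelled w] z T) :
    v.behavior.OutputsWithin [x, encSchedule w]
      (encDistribution [(verdictSchedule tmax (decide (z = [true])), 1)])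
      (T + 8 * x.length + 25 * tmax + 25) := by
  obtain ⟨s, hs, h0, h1, h2, h3⟩ := exists_runsWithin_verifySpelled hw hv
  set b := decide (z = [true])
  have hcode : (encLoc (verdictLoc b)).length ≤ 3 := by
    cases b <;> simp [verdictLoc, encLoc, encUnary]
  have hwrite := (runsWithin_pushList 0 distributionTail s).seq
    ((runsWithin_appendFlatMap (src := 2) (dst := 0) (tmp := 1) (fun _ => hcode) (by norm_num)
      (by norm_num) (by norm_num) (by simpa using h1)).seq
      (runsWithin_pushList 0 (true :: encLoc (corridorStart 0)) _))
  refine ((hs.seq (hwrite.branchTop h3)).mono ?_).outputsWithin ?_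
  · simp +arith [length_distributionTail, h2, encLoc, encUnary, corridorStart]
  · simp [encDistribution_verdictSchedule, h0, h2]

/-- Tell from an input and the answer `true :: encSchedule w` whether the verifier `v` accepts the
string spelled by `w`. -/
def decider (v : Prog) : Prog := .seq (.pop 1) (.seq v.verifySpelled (move 3 0))

lemma decider_outputsWithin (hw : w 0 = corridorStart)
    (hv : v.OutputsWithin [x, spelled w] z T) :
    v.decider.OutputsWithin [x, true :: encSchedule w] [decide (z = [true])]
      (T + 8 * x.length + 25 * tmax + 25) := by
  obtain ⟨s, hs, h0, -, -, h3⟩ := exists_runsWithin_verifySpelled hw hv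
  have hpop := (runsWithin_pop 1 (initStore [x, true :: encSchedule w])).congr
    (s' := initStore [x, encSchedule w]) rfl (by simp [update_initStore, initStore_apply]) le_rfl
  refine ((hpop.seq (hs.seq (runsWithin_move (by norm_num) s))).mono ?_).outputsWithin ?_
  · simp +arith [h3]
  · simp [h0, h3]

end Prog

/-! ### The reduction -/

/-- On every pair of inputs, `v` computes `f` within the time bound `q` in terms of their total
length. -/
def Prog.ComputesWithin₂ (v : Prog) (f : List Bool → List Bool → List Bool) (q : Polynomial ℕ) :
    Prop :=
  ∀ x y, v.OutputsWithin [x, y] (f x y) (q.eval (x.length + y.length))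

section Reduction

variable {v : Prog} {verify : List Bool → List Bool → List Bool} {qv : Polynomial ℕ}

lemma eval_mono (q : Polynomial ℕ) : Monotone fun n => q.eval n := fun a b hab => by
  simp only [Polynomial.eval_eq_sum_range]
  gcongr

/-- A bound on the running times of `Prog.behavior` and `Prog.decider` in terms of the length of the
input, where `q` bounds the length of certificates and `qv` the running time of the verifier. -/
noncomputable def reductionBound (q qv : Polynomial ℕ) : Polynomial ℕ :=
  qv.comp (Polynomial.X + q) + 8 * Polynomial.X + 25 * (q + 1) + 25

lemma eval_reductionBound (q qv : Polynomial ℕ) (n : ℕ) : (reductionBound q qv).eval n =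
    qv.eval (n + q.eval n) + 8 * n + 25 * (q.eval n + 1) + 25 := by
  simp [reductionBound, Polynomial.eval_comp]

lemma verifier_outputsWithin_spelled
    (hv : v.ComputesWithin₂ verify qv) (x : List Bool) (es : SES corridor corridorStart (N + 1)) :
    v.OutputsWithin [x, spelled es.1] (verify x (spelled es.1)) (qv.eval (x.length + N)) :=
  let ⟨s, t, ht, h⟩ := hv x (spelled es.1)
  ⟨s, t, ht.trans (eval_mono qv (Nat.add_le_add_left (length_spelled_le_of_ses es) _)), h⟩

/-- The instance that asks for a schedule that spells a certificate for `x`. -/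
noncomputable def certificateInstance (hv : v.ComputesWithin₂ verify qv) (q : Polynomial ℕ)
    (x : List Bool) : EPInstance where
  n := 2
  m := 1
  tmax := q.eval x.length + 1
  F :=
    { G := corridor
      s₀ := corridorStart
      β := verdictModel _ fun c => decide (verify x c = [true]) }
  D := Fin.last _
  prog := v.behavior
  param := x
  bound := (reductionBound q qv).eval x.length
  describes := describes_deterministicModel fun es => by
    rw [eval_reductionBound]
    exact Prog.behavior_outputsWithin es.2.start (verifier_outputsWithin_spelled hv x es)

lemma polyTime_enc_certificateInstance (hv : v.ComputesWithin₂ verify qv) (q : Polynomial ℕ) :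
    PolyTime fun x => (certificateInstance hv q x).enc := by
  have henc (x : List Bool) : (certificateInstance hv q x).enc =
      encUnary 2 ++ encUnary 1 ++ encUnary ((q + 1).eval x.length) ++
        encUnary ((q + 1).eval x.length) ++ corridor.enc ++ encState corridorStart ++
        v.behavior.enc ++ encString x ++ encUnary ((reductionBound q qv).eval x.length) := by
    simp [EPInstance.enc, certificateInstance]
  simp only [henc]
  exact ((((((((PolyWritable.const _).append (.const _)).append (.encUnary_eval _)).append
    (.encUnary_eval _)).append (.const _)).append (.const _)).append (.const _)).append
    .encString).append (.encUnary_eval _) |>.polyTime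

lemma decider_outputsWithin_spelled (hv : v.ComputesWithin₂ verify qv) (q : Polynomial ℕ)
    (x : List Bool) (es : SES corridor corridorStart (q.eval x.length + 1)) :
    v.decider.OutputsWithin [x, true :: encSchedule es.1]
      [decide (verify x (spelled es.1) = [true])] ((reductionBound q qv).eval x.length) := by
  rw [eval_reductionBound]
  exact Prog.decider_outputsWithin es.2.start (verifier_outputsWithin_spelled hv x es)

lemma verify_spelled_iff_of_isOptimal (hv : v.ComputesWithin₂ verify qv) (q : Polynomial ℕ)
    {x : List Bool} {es : SES corridor corridorStart (q.eval x.length + 1)}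
    (hes : (certificateInstance hv q x).IsOptimal es) :
    verify x (spelled es.1) = [true] ↔
      ∃ c : List Bool, c.length ≤ q.eval x.length ∧ verify x c = [true] := by
  simpa only [decide_eq_true_eq] using
    accepts_spelled_iff_exists (accepts := fun c => decide (verify x c = [true]))
      Fin.last_pos'.ne' hes

end Reduction

end Evac

theorem mainTheorem2 : Evac.EP.NPHard := by
  rintro L ⟨verify, q, ⟨v, qv, hv⟩, hL⟩
  refine ⟨Evac.certificateInstance hv q, v.decider, Evac.reductionBound q qv,
    Evac.polyTime_enc_certificateInstance hv q, fun x => ⟨Evac.EPInstance.exists_isAnswer _, ?_⟩⟩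
  rintro _ (⟨es, hes, rfl⟩ | ⟨hnone, -⟩)
  · refine ⟨_, Evac.decider_outputsWithin_spelled hv q x es, ?_⟩
    rw [hL, ← Evac.verify_spelled_iff_of_isOptimal hv q hes]
    simp
  · obtain ⟨es, -⟩ := Evac.exists_ses_spelled_eq (c := []) (Nat.zero_le (q.eval x.length))
    exact hnone.elim es
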